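/- Fix an integer $k \ge 0$. All graphs are finite, simple and connected; a graph $G$ on $n$ vertices is $3$-connected if $n \ge 4$ and $G \setminus X$ is connected for every set $X$ of two vertices. The vertices of $G$ carry pairwise distinct identifiers in $\{1,\dots,n^k\}$. An assignment gives a finite binary string (label) to every vertex and to every edge of $G$. A verifier is a fixed function, the same for all graphs, by which each vertex accepts or rejects as a function only of its own identifier and label and of the set of triples (identifier of $w$, label of $w$, label of the edge $vw$) over its neighbours $w$. Then $3$-connected graphs can be certified with labels of $O(\log n)$ bits on the vertices and $O(1)$ bits on the edges: there are functions $f, g : \mathbb{N} \to \mathbb{N}$ with $f(n) = O(\log n)$ and $g(n) = O(1)$, and a verifier, such that for every connected graph $G$ on $n$ vertices and every such choice of identifiers: 1. if $G$ is $3$-connected, then there is an assignment with labels of at most $f(n)$ bits on the vertices and at most $g(n)$ bits on the edges for which all vertices accept; 2. if $G$ is not $3$-connected, then for every assignment, with labels of any size, at least one vertex rejects. -/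

import Mathlib

namespace LocalCert

/-- `G` is `k`-(vertex-)connected: it has more than `k` vertices, and there is no set `X` of `k - 1`
vertices such that `G ∖ X` is not connected. -/
def IsKConnected {V : Type} [Fintype V] (k : ℕ) (G : SimpleGraph V) : Prop :=
  k < Fintype.card V ∧
    ∀ X : Finset V, X.card + 1 = k → (G.induce {v : V | v ∉ X}).Connected

/-- A certificate (label) is a finite string of bits; its size is its length. -/
abbrev Label : Type := List Bool

/-- What a node sees at distance 1 in an edge certification: its own identifier and label, and, for
each neighbour, the triple (identifier of the neighbour, label of the neighbour, label of the edge
that joins them). -/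
structure View where
  ident : ℕ
  label : Label
  nbrs : Set (ℕ × Label × Label)

/-- The view of the node `v` in the graph `G` with identifiers `ident`, node labels `c` and (symmetric)
edge labels `e`; only the values of `e` on edges of `G` are ever read. -/
def view {V : Type} (G : SimpleGraph V) (ident : V → ℕ) (c : V → Label) (e : Sym2 V → Label)
    (v : V) : View where
  ident := ident v
  label := c v
  nbrs := {t | ∃ w, G.Adj v w ∧ t = (ident w, c w, e s(v, w))}

/-- A verifier: each node outputs accept (`True`) or reject (`False`), as a function of its view only. -/
abbrev Verifier : Type := View → Prop

/-- The verifier accepts an instance when every node outputs accept. -/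
def Verifier.Accepts (A : Verifier) {V : Type} (G : SimpleGraph V) (ident : V → ℕ)
    (c : V → Label) (e : Sym2 V → Label) : Prop :=
  ∀ v, A (view G ident c e v)

/-- Unique identifiers in the polynomial range `[1, n ^ k]`, where `n` is the number of nodes. -/
def IsIdent {V : Type} [Fintype V] (k : ℕ) (ident : V → ℕ) : Prop :=
  Function.Injective ident ∧ ∀ v, 1 ≤ ident v ∧ ident v ≤ Fintype.card V ^ k

/-- The class `C` of graphs can be certified, among connected graphs with identifiers in `[1, n ^ k]`,
with labels of at most `f n` bits on the nodes and at most `g n` bits on the edges. One verifier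
serves all graphs. The size bounds apply to the labels that the prover gives to the graphs of `C`;
on connected graphs outside `C` no labels of any size are accepted. -/
def CertifiableWith (k : ℕ) (C : ∀ {V : Type} [Fintype V], SimpleGraph V → Prop)
    (f g : ℕ → ℕ) : Prop :=
  ∃ A : Verifier, ∀ (V : Type) [Fintype V] (G : SimpleGraph V) (ident : V → ℕ),
    G.Connected → IsIdent k ident →
      (C G → ∃ (c : V → Label) (e : Sym2 V → Label),
        (∀ v, (c v).length ≤ f (Fintype.card V)) ∧
        (∀ a ∈ G.edgeSet, (e a).length ≤ g (Fintype.card V)) ∧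
        A.Accepts G ident c e) ∧
      (¬ C G → ∀ (c : V → Label) (e : Sym2 V → Label), ¬ A.Accepts G ident c e)

end LocalCert

namespace LocalCert

open SimpleGraph

/-! The certificate is a vertex ordering in the spirit of three independent spanning trees. For a
root `r`, two ranks `p` and `q` give each ordinary vertex three routes to `r`: down in `p`, up in
`p` to a neighbour `t` of `r`, and up in `q` to a neighbour `u` of `r`. The first two never increase
`q`. Relative to the starting vertex, the three routes run in disjoint regions, apart from a last
step to `r`, so two deleted vertices other than `r` cannot block all three
(`TriOrder.reachIn_root`). Every condition concerns one vertex and its neighbours, hence is locally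
checkable. Four orders with distinct roots guarantee more than three vertices and a root outside any
deleted pair (`isKConnected_three_of_triOrder`).

Conversely, a 3-connected graph has such an order for each root (`IsKConnected.exists_triOrder`).
Starting from the edge `rt`, one adds ears whose removal keeps the rest connected, with `u` in the
rest, and whose vertices all have neighbours in the rest (`exists_nonseparating_ear`). The rank `p`
places each ear between two consecutive old values, while `q` records the step of insertion.
Neighbours in the rest come later, which gives the third route.

Identifiers and ranks are polynomial in the number of vertices, so the vertex labels have
logarithmic length; the edge labels are empty. -/

/-! ### Walks inside a vertex set, and 3-connectivity in terms of them. -/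

/-- `s` and `t` are joined by a walk of `G` all of whose vertices lie in `Y`. -/
def ReachIn {V : Type} (G : SimpleGraph V) (Y : Set V) (s t : V) : Prop :=
  ∃ w : G.Walk s t, ∀ x ∈ w.support, x ∈ Y

namespace ReachIn

variable {V : Type} {G : SimpleGraph V} {Y Z : Set V} {s t u : V}

lemma refl (hs : s ∈ Y) : ReachIn G Y s s :=
  ⟨Walk.nil, by simpa using hs⟩

lemma symm (h : ReachIn G Y s t) : ReachIn G Y t s := by
  obtain ⟨w, hw⟩ := h
  exact ⟨w.reverse, by simpa using hw⟩

lemma trans (h : ReachIn G Y s t) (h' : ReachIn G Y t u) : ReachIn G Y s u := by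
  obtain ⟨w, hw⟩ := h
  obtain ⟨w', hw'⟩ := h'
  refine ⟨w.append w', fun x hx => ?_⟩
  rcases (Walk.mem_support_append_iff w w').1 hx with h | h
  exacts [hw x h, hw' x h]

lemma mono (hYZ : Y ⊆ Z) (h : ReachIn G Y s t) : ReachIn G Z s t := by
  obtain ⟨w, hw⟩ := h
  exact ⟨w, fun x hx => hYZ (hw x hx)⟩

lemma mem_left (h : ReachIn G Y s t) : s ∈ Y := by
  obtain ⟨w, hw⟩ := h
  exact hw _ w.start_mem_support

lemma mem_right (h : ReachIn G Y s t) : t ∈ Y := h.symm.mem_left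

lemma of_adj (h : G.Adj s t) (hs : s ∈ Y) (ht : t ∈ Y) : ReachIn G Y s t :=
  ⟨h.toWalk, by simp [hs, ht]⟩

/-- A walk that leaves the set `K` crosses an edge from `K` to its complement. -/
lemma exists_crossing (h : ReachIn G Y s t) {K : Set V} (hs : s ∈ K) (ht : t ∉ K) :
    ∃ x ∈ K, ∃ y ∉ K, G.Adj x y ∧ x ∈ Y ∧ y ∈ Y := by
  obtain ⟨w, hw⟩ := h
  induction w with
  | nil => exact absurd hs ht
  | @cons a b c hab w ih =>
    by_cases hb : b ∈ K
    · exact ih hb ht fun x hx => hw x (by simp [hx])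
    · exact ⟨a, hs, b, hb, hab, hw a (by simp), hw b (by simp)⟩

end ReachIn

lemma reachIn_of_connected_induce {V : Type} {G : SimpleGraph V} {Y : Set V}
    (h : (G.induce Y).Connected) {s t : V} (hs : s ∈ Y) (ht : t ∈ Y) : ReachIn G Y s t := by
  obtain ⟨w⟩ := h.preconnected ⟨s, hs⟩ ⟨t, ht⟩
  refine ⟨w.map (Embedding.induce Y).toHom, fun x hx => ?_⟩
  obtain ⟨y, -, rfl⟩ := List.mem_map.1 ((Walk.support_map (Embedding.induce Y).toHom w) ▸ hx)
  exact y.2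

lemma connected_induce_of_reachIn {V : Type} {G : SimpleGraph V} {Y : Set V} {r : V}
    (hr : r ∈ Y) (h : ∀ v ∈ Y, ReachIn G Y v r) : (G.induce Y).Connected := by
  have hreach : ∀ v : Y, (G.induce Y).Reachable v ⟨r, hr⟩ := by
    rintro ⟨v, hv⟩
    obtain ⟨w, hw⟩ := h v hv
    exact ⟨w.induce Y hw⟩
  exact (connected_iff_exists_forall_reachable _).2 ⟨⟨r, hr⟩, fun v => (hreach v).symm⟩

/-- In a `3`-connected graph the removal of at most two vertices leaves any two vertices joined. -/
lemma IsKConnected.reachIn_compl {V : Type} [Fintype V] {G : SimpleGraph V}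
    (hG : IsKConnected 3 G) {x y s t : V} (hs : s ≠ x ∧ s ≠ y) (ht : t ≠ x ∧ t ≠ y) :
    ReachIn G {v | v ≠ x ∧ v ≠ y} s t := by
  classical
  obtain ⟨hcard, hconn⟩ := hG
  have key : ∀ z, z ≠ x → s ≠ z → t ≠ z → ReachIn G {v | v ≠ x ∧ v ≠ z} s t := by
    intro z hzx hsz htz
    have h := hconn {x, z} (by rw [Finset.card_pair hzx.symm])
    exact (reachIn_of_connected_induce h (s := s) (t := t) (by simp [hs.1, hsz])
      (by simp [ht.1, htz])).mono fun v hv => by simpa using hv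
  -- The definition deletes exactly two vertices; if `x = y`, the pair is padded by a vertex other
  -- than `x`, `s`, `t`, available since there are at least four.
  by_cases hxy : y = x
  · obtain ⟨z, hz⟩ : ∃ z, z ∉ ({x, s, t} : Finset V) := by
      by_contra! hcon
      have h1 : Fintype.card V ≤ ({x, s, t} : Finset V).card :=
        Finset.card_le_card fun v _ => hcon v
      have h2 : ({x, s, t} : Finset V).card ≤ 3 := Finset.card_le_three
      omega
    simp only [Finset.mem_insert, Finset.mem_singleton, not_or] at hz
    exact (key z hz.1 (Ne.symm hz.2.1) (Ne.symm hz.2.2)).mono fun v hv => ⟨hv.1, hxy ▸ hv.1⟩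
  · exact key y hxy hs.2 ht.2

/-- In a `3`-connected graph a set `K` has neighbours besides any two given outside vertices, as
soon as some further vertex lies outside `K`. -/
lemma IsKConnected.exists_boundary {V : Type} [Fintype V] {G : SimpleGraph V}
    (hG : IsKConnected 3 G) {K : Set V} {k o x y : V} (hk : k ∈ K) (ho : o ∉ K)
    (hx : x ∉ K) (hy : y ∉ K) (hox : o ≠ x) (hoy : o ≠ y) :
    ∃ c ∈ K, ∃ d ∉ K, G.Adj c d ∧ d ≠ x ∧ d ≠ y := by
  have h := hG.reachIn_compl (x := x) (y := y) (s := k) (t := o)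
    ⟨fun h => hx (h ▸ hk), fun h => hy (h ▸ hk)⟩ ⟨hox, hoy⟩
  obtain ⟨c, hc, d, hd, hcd, -, hdxy⟩ := h.exists_crossing hk ho
  exact ⟨c, hc, d, hd, hcd, hdxy⟩

/-! ### Nonseparating ears. -/

/-- Some walk inside `Y` has ends attached to two distinct vertices of `A`. -/
def HasEar {V : Type} (G : SimpleGraph V) (A Y : Set V) : Prop :=
  ∃ a ∈ A, ∃ b ∈ A, a ≠ b ∧ ∃ s t, G.Adj a s ∧ G.Adj b t ∧ ReachIn G Y s t

/-- The component of `k` outside `A` and `u` has its boundary in `A ∪ {u}`; by 3-connectivity this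
boundary contains two vertices of `A`. This starts the maximality argument with the connected set
`{u}`. -/
lemma hasEar_diff_singleton {V : Type} [Fintype V] {G : SimpleGraph V} (hG : IsKConnected 3 G)
    {A : Set V} {a₁ a₂ u k : V} (ha₁ : a₁ ∈ A) (ha₂ : a₂ ∈ A) (ha : a₁ ≠ a₂) (hu : u ∉ A)
    (hk : k ∉ A) (hku : k ≠ u) : HasEar G A (Aᶜ \ {u}) := by
  set K : Set V := {v | ReachIn G (Aᶜ \ {u}) k v} with hK
  have hkK : k ∈ K := ReachIn.refl ⟨hk, hku⟩
  have hKA : ∀ v ∈ A, v ∉ K := fun v hv h => (ReachIn.mem_right h).1 hv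
  have huK : u ∉ K := fun h => (ReachIn.mem_right h).2 rfl
  have hout : ∀ c ∈ K, ∀ d ∉ K, G.Adj c d → d ≠ u → d ∈ A := by
    intro c hc d hd hcd hdu
    by_contra hdA
    exact hd (ReachIn.trans hc (ReachIn.of_adj hcd hc.mem_right ⟨hdA, hdu⟩))
  obtain ⟨c, hc, d, hd, hcd, hdu, -⟩ := hG.exists_boundary hkK (hKA _ ha₁) huK huK
    (fun h => hu (h ▸ ha₁)) (fun h => hu (h ▸ ha₁))
  have hdA := hout c hc d hd hcd hdu
  obtain ⟨o, hoA, hod⟩ : ∃ o ∈ A, o ≠ d := by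
    by_cases h : a₁ = d
    · exact ⟨a₂, ha₂, fun h' => ha (h.trans h'.symm)⟩
    · exact ⟨a₁, ha₁, h⟩
  obtain ⟨c', hc', d', hd', hcd', hdu', hdd⟩ := hG.exists_boundary hkK (hKA _ hoA) huK hd
    (fun h => hu (h ▸ hoA)) hod
  exact ⟨d, hdA, d', hout c' hc' d' hd' hcd' hdu', hdd.symm, c, c', hcd.symm, hcd'.symm,
    (ReachIn.symm hc).trans hc'⟩

/-- This and the next lemma supply the pieces of an old ear that survive when it is rerouted around
one of its vertices. -/
lemma reachIn_initial_segment {V : Type} {G : SimpleGraph V} {s t : V} {w : G.Walk s t} (hw : w.IsPath)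
    {X : Set V} (hX : ∀ x ∈ w.support, x ∈ X) {i j : ℕ} (hij : i < j) (hj : j ≤ w.length) :
    ReachIn G (X \ {w.getVert j}) s (w.getVert i) := by
  refine ⟨w.take i, fun x hx => ?_⟩
  obtain ⟨n, rfl, hn⟩ := Walk.mem_support_iff_exists_getVert.1 hx
  rw [Walk.take_getVert]
  refine ⟨hX _ (w.getVert_mem_support _), fun h => ?_⟩
  have := hw.getVert_injOn (show min i n ≤ w.length by omega) hj h
  omega

lemma reachIn_final_segment {V : Type} {G : SimpleGraph V} {s t : V} {w : G.Walk s t} (hw : w.IsPath)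
    {X : Set V} (hX : ∀ x ∈ w.support, x ∈ X) {i j : ℕ} (hij : i < j) (hj : j ≤ w.length) :
    ReachIn G (X \ {w.getVert i}) (w.getVert j) t := by
  refine ⟨w.drop j, fun x hx => ?_⟩
  obtain ⟨n, rfl, hn⟩ := Walk.mem_support_iff_exists_getVert.1 hx
  rw [Walk.drop_length] at hn
  rw [Walk.drop_getVert]
  refine ⟨hX _ (w.getVert_mem_support _), fun h => ?_⟩
  have := hw.getVert_injOn (show j + n ≤ w.length by omega) (show i ≤ w.length by omega) h
  omega

/-- If every vertex of `X` attached to `D` lies on every ear through `X`, then every vertex of `X`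
is attached to `D`. -/
lemma forall_attached {V : Type} [Fintype V] {G : SimpleGraph V} (hG : IsKConnected 3 G)
    {A D X : Set V} (hcover : ∀ v, v ∈ A ∨ v ∈ D ∨ v ∈ X) (hDX : ∀ v ∈ D, v ∉ X) {u : V}
    (huA : u ∉ A) (huD : u ∈ D) (hXA : ∀ v ∈ X, v ∉ A)
    (hne : ∃ z ∈ X, ∃ d ∈ D, G.Adj z d)
    (hmin : ∀ z ∈ X, (∃ d ∈ D, G.Adj z d) → ¬ HasEar G A (X \ {z}))
    {a b s t : V} (ha : a ∈ A) (hb : b ∈ A) (hab : a ≠ b) (has : G.Adj a s) (hbt : G.Adj b t)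
    {w : G.Walk s t} (hw : w.IsPath) (hwX : ∀ x ∈ w.support, x ∈ X) :
    ∀ x ∈ X, ∃ d ∈ D, G.Adj x d := by
  by_contra! hcon
  obtain ⟨k, hkX, hkD⟩ := hcon
  set Z : Set V := {z | z ∈ X ∧ ∃ d ∈ D, G.Adj z d} with hZ
  -- All neighbours of `K` lie in `A` or `Z`, and `Z` lies on the path. Three of them are distinct
  -- by 3-connectivity; however they are distributed, a detour through `K` yields an ear missing
  -- some vertex of `Z`, against `hmin`.
  set K : Set V := {v | ReachIn G (X \ Z) k v} with hK
  have hkZ : k ∉ Z := fun ⟨_, d, hd, h⟩ => hkD d hd h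
  have hkK : k ∈ K := ReachIn.refl ⟨hkX, hkZ⟩
  have hKX : ∀ v ∈ K, v ∈ X \ Z := fun v hv => ReachIn.mem_right hv
  have hKK : ∀ z ∈ Z, ∀ c ∈ K, ∀ d ∈ K, ReachIn G (X \ {z}) c d := fun z hz c hc d hd =>
    ((ReachIn.symm hc).trans hd).mono fun v hv => ⟨hv.1, fun h => hv.2 (h ▸ hz)⟩
  have huK : u ∉ K := fun h => hDX u huD (hKX u h).1
  have hout : ∀ c ∈ K, ∀ d ∉ K, G.Adj c d → d ∈ A ∨ d ∈ Z := by
    intro c hc d hd hcd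
    rcases hcover d with h | h | h
    · exact Or.inl h
    · exact absurd ⟨(hKX c hc).1, d, h, hcd⟩ (hKX c hc).2
    · by_contra! hdZ
      exact hd (ReachIn.trans hc (ReachIn.of_adj hcd (hKX c hc) ⟨h, hdZ.2⟩))
  have hAZu : ∀ d, d ∈ A ∨ d ∈ Z → u ≠ d := by
    rintro d (h | h) rfl
    exacts [huA h, hDX _ huD h.1]
  have hZon : ∀ z ∈ Z, ∃ i ≤ w.length, w.getVert i = z := by
    intro z hz
    have : z ∈ w.support := by
      by_contra hzw
      exact hmin z hz.1 hz.2 ⟨a, ha, b, hb, hab, s, t, has, hbt, w,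
        fun x hx => ⟨hwX x hx, fun h => hzw (h ▸ hx)⟩⟩
    obtain ⟨i, hi, hil⟩ := Walk.mem_support_iff_exists_getVert.1 this
    exact ⟨i, hil, hi⟩
  have hstep : ∀ z ∈ Z, ∀ c ∈ K, ∀ d, d ∈ X → d ≠ z → G.Adj c d → ReachIn G (X \ {z}) c d :=
    fun z hz c hc d hd hdz hcd =>
      ReachIn.of_adj hcd ((hKX c hc).imp id fun h h' => h (h' ▸ hz)) ⟨hd, hdz⟩
  -- at most one neighbour of `K` in `A`
  have hAA : ∀ c ∈ K, ∀ c' ∈ K, ∀ d ∈ A, ∀ d' ∈ A, d ≠ d' → G.Adj c d → G.Adj c' d' → False := by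
    intro c hc c' hc' d hd d' hd' hdd h h'
    obtain ⟨z, hzX, hzD⟩ := hne
    exact hmin z hzX hzD ⟨d, hd, d', hd', hdd, c, c', h.symm, h'.symm,
      hKK z ⟨hzX, hzD⟩ c hc c' hc'⟩
  have hinj : ∀ i ≤ w.length, ∀ j ≤ w.length, i ≠ j → w.getVert i ≠ w.getVert j :=
    fun i hi j hj hij h => hij (hw.getVert_injOn hi hj h)
  -- one neighbour in `A` and two on the path
  have hAZZ' : ∀ c ∈ K, ∀ i j, i < j → j ≤ w.length → w.getVert i ∈ Z → w.getVert j ∈ Z →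
      ∀ c₁ ∈ K, ∀ c₂ ∈ K, G.Adj c₁ (w.getVert i) → G.Adj c₂ (w.getVert j) →
      ∀ d ∈ A, G.Adj c d → False := by
    intro c hc i j hij hj hi hjZ c₁ hc₁ c₂ hc₂ h₁ h₂ d hd hcd
    have hne' := hinj i (by omega) j hj hij.ne
    -- The new ear keeps the end of the path whose attachment differs from `d`: the initial piece
    -- from `a` if `d = b`, otherwise the final piece towards `b`.
    by_cases hdb : d = b
    · refine hmin _ hjZ.1 hjZ.2 ⟨a, ha, d, hd, hdb ▸ hab, s, c, has, hcd.symm, ?_⟩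
      exact (reachIn_initial_segment hw hwX hij hj).trans
        ((hstep _ hjZ c₁ hc₁ _ hi.1 hne' h₁).symm.trans (hKK _ hjZ c₁ hc₁ c hc))
    · refine hmin _ hi.1 hi.2 ⟨d, hd, b, hb, hdb, c, t, hcd.symm, hbt, ?_⟩
      exact (hKK _ hi c hc c₂ hc₂).trans
        ((hstep _ hi c₂ hc₂ _ hjZ.1 hne'.symm h₂).trans (reachIn_final_segment hw hwX hij hj))
  have hAZZ : ∀ c ∈ K, ∀ c₁ ∈ K, ∀ c₂ ∈ K, ∀ d ∈ A, ∀ z₁ ∈ Z, ∀ z₂ ∈ Z, z₁ ≠ z₂ →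
      G.Adj c d → G.Adj c₁ z₁ → G.Adj c₂ z₂ → False := by
    intro c hc c₁ hc₁ c₂ hc₂ d hd z₁ hz₁ z₂ hz₂ hzz h h₁ h₂
    obtain ⟨i, hi, rfl⟩ := hZon z₁ hz₁
    obtain ⟨j, hj, rfl⟩ := hZon z₂ hz₂
    rcases lt_trichotomy i j with hij | rfl | hij
    · exact hAZZ' c hc i j hij hj hz₁ hz₂ c₁ hc₁ c₂ hc₂ h₁ h₂ d hd h
    · exact hzz rfl
    · exact hAZZ' c hc j i hij hi hz₂ hz₁ c₂ hc₂ c₁ hc₁ h₂ h₁ d hd h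
  -- three neighbours on the path
  have hZZZ' : ∀ i j l, i < j → j < l → l ≤ w.length → w.getVert i ∈ Z → w.getVert j ∈ Z →
      w.getVert l ∈ Z → (∃ c ∈ K, G.Adj c (w.getVert i)) → (∃ c ∈ K, G.Adj c (w.getVert l)) →
      False := by
    rintro i j l hij hjl hl hi hj hlZ ⟨c, hc, h⟩ ⟨c', hc', h'⟩
    refine hmin _ hj.1 hj.2 ⟨a, ha, b, hb, hab, s, t, has, hbt, ?_⟩
    exact (reachIn_initial_segment hw hwX hij (by omega)).trans
      ((hstep _ hj c hc _ hi.1 (hinj i (by omega) j (by omega) hij.ne) h).symm.trans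
        ((hKK _ hj c hc c' hc').trans
          ((hstep _ hj c' hc' _ hlZ.1 (hinj l hl j (by omega) hjl.ne') h').trans
            (reachIn_final_segment hw hwX hjl hl))))
  obtain ⟨c₁, hc₁, d₁, hd₁, h₁, -, -⟩ := hG.exists_boundary hkK huK (x := a) (y := a)
    (fun h => hXA _ (hKX _ h).1 ha) (fun h => hXA _ (hKX _ h).1 ha) (hAZu _ (.inl ha))
    (hAZu _ (.inl ha))
  have k₁ := hout c₁ hc₁ d₁ hd₁ h₁
  obtain ⟨c₂, hc₂, d₂, hd₂, h₂, h₂₁, -⟩ := hG.exists_boundary hkK huK hd₁ hd₁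
    (hAZu _ k₁) (hAZu _ k₁)
  have k₂ := hout c₂ hc₂ d₂ hd₂ h₂
  obtain ⟨c₃, hc₃, d₃, hd₃, h₃, h₃₁, h₃₂⟩ := hG.exists_boundary hkK huK hd₁ hd₂
    (hAZu _ k₁) (hAZu _ k₂)
  have k₃ := hout c₃ hc₃ d₃ hd₃ h₃
  rcases k₁ with k₁ | k₁
  · rcases k₂ with k₂ | k₂
    · exact hAA c₁ hc₁ c₂ hc₂ d₁ k₁ d₂ k₂ h₂₁.symm h₁ h₂
    rcases k₃ with k₃ | k₃
    · exact hAA c₁ hc₁ c₃ hc₃ d₁ k₁ d₃ k₃ h₃₁.symm h₁ h₃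
    · exact hAZZ c₁ hc₁ c₂ hc₂ c₃ hc₃ d₁ k₁ d₂ k₂ d₃ k₃ h₃₂.symm h₁ h₂ h₃
  rcases k₂ with k₂ | k₂
  · rcases k₃ with k₃ | k₃
    · exact hAA c₂ hc₂ c₃ hc₃ d₂ k₂ d₃ k₃ h₃₂.symm h₂ h₃
    · exact hAZZ c₂ hc₂ c₁ hc₁ c₃ hc₃ d₂ k₂ d₁ k₁ d₃ k₃ h₃₁.symm h₂ h₁ h₃
  rcases k₃ with k₃ | k₃
  · exact hAZZ c₃ hc₃ c₁ hc₁ c₂ hc₂ d₃ k₃ d₁ k₁ d₂ k₂ h₂₁.symm h₃ h₁ h₂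
  obtain ⟨i₁, l₁, rfl⟩ := hZon d₁ k₁
  obtain ⟨i₂, l₂, rfl⟩ := hZon d₂ k₂
  obtain ⟨i₃, l₃, rfl⟩ := hZon d₃ k₃
  have e₁ : ∃ c ∈ K, G.Adj c (w.getVert i₁) := ⟨c₁, hc₁, h₁⟩
  have e₂ : ∃ c ∈ K, G.Adj c (w.getVert i₂) := ⟨c₂, hc₂, h₂⟩
  have e₃ : ∃ c ∈ K, G.Adj c (w.getVert i₃) := ⟨c₃, hc₃, h₃⟩
  have n₁ : i₂ ≠ i₁ := fun h => h₂₁ (by rw [h])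
  have n₂ : i₃ ≠ i₁ := fun h => h₃₁ (by rw [h])
  have n₃ : i₃ ≠ i₂ := fun h => h₃₂ (by rw [h])
  rcases lt_or_gt_of_ne n₁ with o₁ | o₁ <;> rcases lt_or_gt_of_ne n₂ with o₂ | o₂ <;>
    rcases lt_or_gt_of_ne n₃ with o₃ | o₃
  · exact hZZZ' _ _ _ o₃ o₁ l₁ k₃ k₂ k₁ e₃ e₁
  · exact hZZZ' _ _ _ o₃ o₂ l₁ k₂ k₃ k₁ e₂ e₁
  · omega
  · exact hZZZ' _ _ _ o₁ o₂ l₃ k₂ k₁ k₃ e₂ e₃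
  · exact hZZZ' _ _ _ o₂ o₁ l₂ k₃ k₁ k₂ e₃ e₂
  · omega
  · exact hZZZ' _ _ _ o₂ o₃ l₂ k₁ k₃ k₂ e₁ e₂
  · exact hZZZ' _ _ _ o₁ o₃ l₃ k₁ k₂ k₃ e₁ e₃

/-- Nonseparating ears: the connected complement of `A` splits into a path `X` attached to two
distinct vertices of `A` and a connected set `D ∋ u` to which every vertex of `X` is attached. -/
lemma exists_nonseparating_ear {V : Type} [Fintype V] {G : SimpleGraph V} (hG : IsKConnected 3 G)
    {A : Set V} {a₁ a₂ u k : V} (ha₁ : a₁ ∈ A) (ha₂ : a₂ ∈ A) (ha : a₁ ≠ a₂) (hu : u ∉ A)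
    (hk : k ∉ A) (hku : k ≠ u) (hconn : ∀ v ∉ A, ReachIn G Aᶜ u v) :
    ∃ a ∈ A, ∃ b ∈ A, a ≠ b ∧ ∃ s t, G.Adj a s ∧ G.Adj b t ∧ ∃ w : G.Walk s t, w.IsPath ∧
      u ∉ w.support ∧ (∀ x ∈ w.support, x ∉ A) ∧
      (∀ x ∈ w.support, ∃ d, d ∉ A ∧ d ∉ w.support ∧ G.Adj x d) ∧
      ∀ v, v ∉ A → v ∉ w.support → ReachIn G {v | v ∉ A ∧ v ∉ w.support} u v := by
  classical
  -- A maximal connected `D ∋ u` that leaves room for an ear is chosen; no vertex attached to it can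
  -- be added without destroying all ears.
  let Good : Set V → Prop := fun D =>
    D ⊆ Aᶜ ∧ u ∈ D ∧ (∀ d ∈ D, ReachIn G D u d) ∧ HasEar G A (Aᶜ \ D)
  have hstart : Good {u} := ⟨by simpa using hu, rfl,
    fun d hd => by rw [Set.mem_singleton_iff.1 hd]; exact ReachIn.refl rfl,
    hasEar_diff_singleton hG ha₁ ha₂ ha hu hk hku⟩
  obtain ⟨D, -, ⟨hDA, huD, hDconn, hear⟩, hmax⟩ := Finite.exists_le_maximal hstart
  have hmin : ∀ z ∈ Aᶜ \ D, (∃ d ∈ D, G.Adj z d) → ¬ HasEar G A ((Aᶜ \ D) \ {z}) := by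
    rintro z hz ⟨d, hd, hzd⟩ hE
    have hgood : Good (insert z D) := by
      refine ⟨Set.insert_subset hz.1 hDA, Set.mem_insert_of_mem _ huD, ?_, ?_⟩
      · have hsub : D ⊆ insert z D := Set.subset_insert z D
        rintro v (rfl | hv)
        · exact ((hDconn d hd).mono hsub).trans
            (ReachIn.of_adj hzd.symm (hsub hd) (Set.mem_insert v D))
        · exact (hDconn v hv).mono hsub
      · rwa [Set.sdiff_sdiff, Set.union_singleton] at hE
    exact hz.2 (hmax hgood (Set.subset_insert z D) (Set.mem_insert z D))
  obtain ⟨a, haA, b, hbA, hab, s, t, has, hbt, w', hw'⟩ := hear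
  have hwX : ∀ x ∈ w'.bypass.support, x ∈ Aᶜ \ D :=
    fun x hx => hw' x (w'.support_bypass_subset_support hx)
  have hwP : w'.bypass.IsPath := w'.bypass_isPath
  generalize w'.bypass = w at hwX hwP
  have hs := hwX s w.start_mem_support
  have hne : ∃ z ∈ Aᶜ \ D, ∃ d ∈ D, G.Adj z d := by
    obtain ⟨x, hx, y, hy, hxy, -, hyA⟩ := (hconn s hs.1).exists_crossing huD hs.2
    exact ⟨y, ⟨hyA, hy⟩, x, hx, hxy.symm⟩
  have hatt := forall_attached hG (A := A) (D := D) (X := Aᶜ \ D)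
    (fun v => by
      by_cases h : v ∈ A
      · exact .inl h
      · by_cases h' : v ∈ D
        exacts [.inr (.inl h'), .inr (.inr ⟨h, h'⟩)])
    (fun v hv h => h.2 hv) hu huD (fun v hv => hv.1) hne hmin haA hbA hab has hbt hwP hwX
  -- A vertex off the path could be moved into `D` while the path survives, so the path is
  -- everything outside `A` and `D`.
  have hsupp : ∀ x, x ∉ A → x ∉ D → x ∈ w.support := by
    intro x hxA hxD
    by_contra hxw
    exact hmin x ⟨hxA, hxD⟩ (hatt x ⟨hxA, hxD⟩) ⟨a, haA, b, hbA, hab, s, t, has, hbt, w,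
      fun y hy => ⟨hwX y hy, fun h => hxw (h ▸ hy)⟩⟩
  have hDw : ∀ d ∈ D, d ∉ w.support := fun d hd h => (hwX d h).2 hd
  refine ⟨a, haA, b, hbA, hab, s, t, has, hbt, w, hwP, hDw u huD, fun x hx => (hwX x hx).1,
    fun x hx => ?_, fun v hvA hvw => ?_⟩
  · obtain ⟨d, hd, h⟩ := hatt x (hwX x hx)
    exact ⟨d, hDA hd, hDw d hd, h⟩
  · have hvD : v ∈ D := by
      by_contra h
      exact hvw (hsupp v hvA h)
    exact (hDconn v hvD).mono fun d hd => ⟨hDA hd, hDw d hd⟩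

/-! ### Orders that force 3-connectivity. -/

/-- Two rankings `p`, `q` of the vertices which make `r` reachable from every vertex along three
routes: downwards in `p` to `r`, upwards in `p` to `t` (both without increasing `q`), and upwards
in `q` to `u`. The three special vertices are given by their names. -/
structure TriOrder {V α : Type} (G : SimpleGraph V) (name : V → α) (r t u : α)
    (p q : V → ℕ) : Prop where
  root : ∀ v, name v = t ∨ name v = u → ∃ a, G.Adj v a ∧ name a = r
  down : ∀ v, name v ≠ r → name v ≠ t → name v ≠ u →
    ∃ a, G.Adj v a ∧ name a ≠ t ∧ name a ≠ u ∧ p a < p v ∧ q a ≤ q v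
  up : ∀ v, name v ≠ r → name v ≠ t → name v ≠ u →
    ∃ a, G.Adj v a ∧ name a ≠ r ∧ name a ≠ u ∧ p v < p a ∧ q a ≤ q v
  out : ∀ v, name v ≠ r → name v ≠ t → name v ≠ u →
    ∃ a, G.Adj v a ∧ name a ≠ r ∧ name a ≠ t ∧ q v < q a

namespace TriOrder

variable {V α : Type} {G : SimpleGraph V} {name : V → α} {r t u : α} {p q : V → ℕ}

lemma reachIn_root_of_down (h : TriOrder G name r t u p q) {Y : Set V} (v : V)
    (hv : v ∈ Y) (hr : name v ≠ r) (ht : name v ≠ t) (hu : name v ≠ u)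
    (hY : ∀ a, p a < p v → q a ≤ q v → a ∈ Y) : ∃ w, name w = r ∧ ReachIn G Y v w := by
  induction hn : p v using Nat.strong_induction_on generalizing v with
  | _ n ih =>
    obtain ⟨a, hva, hat, hau, hp, hq⟩ := h.down v hr ht hu
    have haY := hY a hp hq
    have hstep := ReachIn.of_adj hva hv haY
    by_cases har : name a = r
    · exact ⟨a, har, hstep⟩
    · obtain ⟨w, hw, hreach⟩ := ih (p a) (hn ▸ hp) a haY har hat hau
        (fun b hb hb' => hY b (hb.trans hp) (hb'.trans hq)) rfl
      exact ⟨w, hw, hstep.trans hreach⟩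

/-- The climb ends at `t`, whose edge leads to the root. The root may lie outside the region of
`hY`, hence the separate hypothesis `hroot`. -/
lemma reachIn_root_of_up [Finite V] (h : TriOrder G name r t u p q) {Y : Set V}
    (hroot : ∀ w, name w = r → w ∈ Y) (v : V)
    (hv : v ∈ Y) (hr : name v ≠ r) (ht : name v ≠ t) (hu : name v ≠ u)
    (hY : ∀ a, p v < p a → q a ≤ q v → a ∈ Y) : ∃ w, name w = r ∧ ReachIn G Y v w := by
  obtain ⟨M, hM⟩ := (Set.finite_range p).bddAbove
  have hM' : ∀ a, p a ≤ M := fun a => hM ⟨a, rfl⟩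
  induction hn : M - p v using Nat.strong_induction_on generalizing v with
  | _ n ih =>
    obtain ⟨a, hva, har, hau, hp, hq⟩ := h.up v hr ht hu
    have haY := hY a hp hq
    have hstep := ReachIn.of_adj hva hv haY
    by_cases hat : name a = t
    · obtain ⟨w, haw, hw⟩ := h.root a (.inl hat)
      exact ⟨w, hw, hstep.trans (ReachIn.of_adj haw haY (hroot w hw))⟩
    · obtain ⟨w, hw, hreach⟩ := ih (M - p a) (by have := hM' a; omega) a haY har hat hau
        (fun b hb hb' => hY b (hp.trans hb) (hb'.trans hq)) rfl
      exact ⟨w, hw, hstep.trans hreach⟩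

lemma reachIn_root_of_out [Finite V] (h : TriOrder G name r t u p q) {Y : Set V}
    (hroot : ∀ w, name w = r → w ∈ Y) (v : V)
    (hv : v ∈ Y) (hr : name v ≠ r) (ht : name v ≠ t) (hu : name v ≠ u)
    (hY : ∀ a, q v < q a → a ∈ Y) : ∃ w, name w = r ∧ ReachIn G Y v w := by
  obtain ⟨M, hM⟩ := (Set.finite_range q).bddAbove
  have hM' : ∀ a, q a ≤ M := fun a => hM ⟨a, rfl⟩
  induction hn : M - q v using Nat.strong_induction_on generalizing v with
  | _ n ih =>
    obtain ⟨a, hva, har, hat, hq⟩ := h.out v hr ht hu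
    have haY := hY a hq
    have hstep := ReachIn.of_adj hva hv haY
    by_cases hau : name a = u
    · obtain ⟨w, haw, hw⟩ := h.root a (.inr hau)
      exact ⟨w, hw, hstep.trans (ReachIn.of_adj haw haY (hroot w hw))⟩
    · obtain ⟨w, hw, hreach⟩ := ih (M - q a) (by have := hM' a; omega) a haY har hat hau
        (fun b hb => hY b (hq.trans hb)) rfl
      exact ⟨w, hw, hstep.trans hreach⟩

/-- A dishonest label could announce a name borne by no vertex; for `r` this is impossible, since
descending routes end there. For `t` and `u` it does no harm. -/
lemma exists_root (h : TriOrder G name r t u p q) (v : V) : ∃ w, name w = r := by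
  by_cases hr : name v = r
  · exact ⟨v, hr⟩
  by_cases ht : name v = t ∨ name v = u
  · obtain ⟨w, -, hw⟩ := h.root v ht
    exact ⟨w, hw⟩
  · push Not at ht
    obtain ⟨w, hw, -⟩ := h.reachIn_root_of_down (Y := Set.univ) v trivial hr ht.1 ht.2
      fun _ _ _ => trivial
    exact ⟨w, hw⟩

/-- No two vertices other than the root separate a vertex from the root. -/
lemma reachIn_root [Finite V] (h : TriOrder G name r t u p q) {x y : V} (hx : name x ≠ r)
    (hy : name y ≠ r) {v : V} (hvx : v ≠ x) (hvy : v ≠ y) :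
    ∃ w, name w = r ∧ ReachIn G {a | a ≠ x ∧ a ≠ y} v w := by
  have hroot : ∀ w, name w = r → w ∈ {a | a ≠ x ∧ a ≠ y} := by
    intro w hw
    constructor <;> rintro rfl
    exacts [hx hw, hy hw]
  by_cases hr : name v = r
  · exact ⟨v, hr, ReachIn.refl ⟨hvx, hvy⟩⟩
  by_cases ht : name v = t ∨ name v = u
  · obtain ⟨w, hvw, hw⟩ := h.root v ht
    exact ⟨w, hw, ReachIn.of_adj hvw ⟨hvx, hvy⟩ (hroot w hw)⟩
  push Not at ht
  by_cases h₁ : ∀ a, p a < p v → q a ≤ q v → a ∈ {a | a ≠ x ∧ a ≠ y}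
  · exact h.reachIn_root_of_down v ⟨hvx, hvy⟩ hr ht.1 ht.2 h₁
  by_cases h₂ : ∀ a, p v < p a → q a ≤ q v → a ∈ {a | a ≠ x ∧ a ≠ y}
  · exact h.reachIn_root_of_up hroot v ⟨hvx, hvy⟩ hr ht.1 ht.2 h₂
  -- The regions of the three routes are disjoint. If each of the first two contains a deleted
  -- vertex, these are `x` and `y` in some order, and the third contains neither.
  refine h.reachIn_root_of_out hroot v ⟨hvx, hvy⟩ hr ht.1 ht.2 fun a ha => ?_
  simp only [Set.mem_ofPred_eq, not_forall] at h₁ h₂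
  obtain ⟨a₁, hp₁, hq₁, h₁⟩ := h₁
  obtain ⟨a₂, hp₂, hq₂, h₂⟩ := h₂
  constructor
  · rintro rfl
    have e₁ : a₁ = y := by
      by_contra hne
      exact h₁ ⟨by rintro rfl; omega, hne⟩
    have e₂ : a₂ = y := by
      by_contra hne
      exact h₂ ⟨by rintro rfl; omega, hne⟩
    subst e₁
    subst e₂
    omega
  · rintro rfl
    have e₁ : a₁ = x := by
      by_contra hne
      exact h₁ ⟨hne, by rintro rfl; omega⟩
    have e₂ : a₂ = x := by
      by_contra hne
      exact h₂ ⟨hne, by rintro rfl; omega⟩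
    subst e₁
    subst e₂
    omega

/-- Names may be changed along an injection of the vertices. -/
lemma rename {r t u : V} (h : TriOrder G id r t u p q) (hname : Function.Injective name) :
    TriOrder G name (name r) (name t) (name u) p q where
  root v hv := by simpa [hname.eq_iff] using h.root v (by simpa [hname.eq_iff] using hv)
  down v := by simpa [hname.eq_iff, hname.ne_iff] using h.down v
  up v := by simpa [hname.eq_iff, hname.ne_iff] using h.up v
  out v := by simpa [hname.eq_iff, hname.ne_iff] using h.out v

end TriOrder

/-- Four distinctly rooted orders force `3`-connectivity. -/
lemma isKConnected_three_of_triOrder {V α : Type} [Fintype V] [Nonempty V] {G : SimpleGraph V}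
    {name : V → α} (hname : Function.Injective name) {r t u : Fin 4 → α} {p q : Fin 4 → V → ℕ}
    (hr : Function.Injective r)
    (h : ∀ j, TriOrder G name (r j) (t j) (u j) (p j) (q j)) : IsKConnected 3 G := by
  classical
  choose root hroot using fun j => (h j).exists_root (Classical.arbitrary V)
  have hinj : Function.Injective root := fun i j hij => hr (by rw [← hroot i, ← hroot j, hij])
  -- Three roots would suffice to avoid a deleted pair; the fourth proves that there are more than
  -- three vertices.
  refine ⟨by simpa [Nat.succ_le_iff] using Fintype.card_le_of_injective root hinj, fun X hX => ?_⟩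
  obtain ⟨x, y, -, rfl⟩ := Finset.card_eq_two.1 (show X.card = 2 by omega)
  obtain ⟨j, hj⟩ : ∃ j, root j ∉ ({x, y} : Finset V) := by
    by_contra! hcon
    have h₁ := Finset.card_le_card_of_injOn root (s := Finset.univ) (fun j _ => hcon j) hinj.injOn
    have h₂ : ({x, y} : Finset V).card ≤ 2 := Finset.card_le_two
    simp only [Finset.card_univ, Fintype.card_fin] at h₁
    omega
  simp only [Finset.mem_insert, Finset.mem_singleton, not_or] at hj
  have hne : ∀ z, root j ≠ z → name z ≠ r j := fun z hz hzr =>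
    hz (hname (by rw [hroot, hzr]))
  refine connected_induce_of_reachIn (r := root j) (by simpa using hj) fun v hv => ?_
  simp only [Set.mem_ofPred_eq, Finset.mem_insert, Finset.mem_singleton, not_or] at hv
  obtain ⟨w, hw, hreach⟩ := (h j).reachIn_root (hne x hj.1) (hne y hj.2) hv.1 hv.2
  obtain rfl : w = root j := hname (by rw [hw, hroot])
  exact hreach.mono fun a ha => by simpa using ha

/-! ### Construction of the orders by adding ears. -/

/-- A path numbers its vertices so that each has a predecessor and a successor, the ends apart. -/
lemma exists_height_of_isPath {V : Type} {G : SimpleGraph V} {s t : V} {w : G.Walk s t}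
    (hw : w.IsPath) : ∃ h : V → ℕ, Set.InjOn h {x | x ∈ w.support} ∧
      (∀ x ∈ w.support, x = s ∨ ∃ y ∈ w.support, G.Adj x y ∧ h y < h x) ∧
      (∀ x ∈ w.support, x = t ∨ ∃ y ∈ w.support, G.Adj x y ∧ h x < h y) := by
  classical
  have hex : ∀ x, ∃ i, x ∈ w.support → i ≤ w.length ∧ w.getVert i = x := by
    intro x
    by_cases hx : x ∈ w.support
    · obtain ⟨i, hi, hil⟩ := Walk.mem_support_iff_exists_getVert.1 hx
      exact ⟨i, fun _ => ⟨hil, hi⟩⟩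
    · exact ⟨0, fun h => absurd h hx⟩
  choose h hh using hex
  have hget : ∀ i ≤ w.length, h (w.getVert i) = i := fun i hi =>
    hw.getVert_injOn (hh _ (w.getVert_mem_support i)).1 hi (hh _ (w.getVert_mem_support i)).2
  refine ⟨h, fun x hx y hy hxy => ?_, fun x hx => ?_, fun x hx => ?_⟩
  · rw [← (hh x hx).2, ← (hh y hy).2, hxy]
  · obtain ⟨hl, hx'⟩ := hh x hx
    rcases Nat.eq_zero_or_pos (h x) with h0 | h0
    · left
      rw [← hx', h0, Walk.getVert_zero]
    · right
      refine ⟨w.getVert (h x - 1), w.getVert_mem_support _, ?_, ?_⟩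
      · have := w.adj_getVert_succ (i := h x - 1) (by omega)
        rw [Nat.sub_add_cancel h0, hx'] at this
        exact this.symm
      · rw [hget _ (by omega)]
        omega
  · obtain ⟨hl, hx'⟩ := hh x hx
    rcases hl.eq_or_lt with h0 | h0
    · left
      rw [← hx', h0, Walk.getVert_length]
    · right
      refine ⟨w.getVert (h x + 1), w.getVert_mem_support _, ?_, ?_⟩
      · have := w.adj_getVert_succ h0
        rwa [hx'] at this
      · rw [hget _ (by omega)]
        omega

/-- A partial order structure on the set `A`: as in `TriOrder`, where the third route may also
leave `A`. -/
structure PartialTriOrder {V : Type} (G : SimpleGraph V) (r t u : V) (A : Set V)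
    (p : V → ℚ) (q : V → ℕ) (m : ℕ) : Prop where
  mem_r : r ∈ A
  mem_t : t ∈ A
  notMem_u : u ∉ A
  connected : ∀ v ∉ A, ReachIn G Aᶜ u v
  injOn : Set.InjOn p A
  bot_le : ∀ v ∈ A, p r ≤ p v
  le_top : ∀ v ∈ A, p v ≤ p t
  lt_step : ∀ v ∈ A, q v < m
  down : ∀ v ∈ A, v ≠ r → v ≠ t → ∃ a ∈ A, G.Adj v a ∧ p a < p v ∧ q a ≤ q v
  up : ∀ v ∈ A, v ≠ r → v ≠ t → ∃ a ∈ A, G.Adj v a ∧ p v < p a ∧ q a ≤ q v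
  out : ∀ v ∈ A, v ≠ r → v ≠ t → ∃ a, G.Adj v a ∧ a ≠ r ∧ a ≠ t ∧ (a ∈ A → q v < q a)

/-- Adding a nonseparating ear whose ends are attached to `a` and `b` with `p a < p b`. -/
lemma PartialTriOrder.add_ear {V : Type} [Finite V] {G : SimpleGraph V} {r t u : V} {A : Set V}
    {p : V → ℚ} {q : V → ℕ} {m : ℕ} (h : PartialTriOrder G r t u A p q m) {a b s e : V}
    (ha : a ∈ A) (hb : b ∈ A) (hab : p a < p b) (has : G.Adj a s) (hbe : G.Adj b e)
    {w : G.Walk s e} (hw : w.IsPath) (huw : u ∉ w.support) (hwA : ∀ x ∈ w.support, x ∉ A)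
    (hout : ∀ x ∈ w.support, ∃ d, d ∉ A ∧ d ∉ w.support ∧ G.Adj x d)
    (hconn : ∀ v, v ∉ A → v ∉ w.support → ReachIn G {v | v ∉ A ∧ v ∉ w.support} u v) :
    ∃ p' q', PartialTriOrder G r t u (A ∪ {x | x ∈ w.support}) p' q' (m + 1) := by
  classical
  -- `c` is the successor of `a` in `p`. The ear goes into the gap between them, so its values are
  -- new and still below `p b`; rational values make every gap large enough.
  obtain ⟨c, ⟨hcA, hac⟩, hc⟩ := Set.exists_min_image {v | v ∈ A ∧ p a < p v} p (Set.toFinite _)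
    ⟨b, hb, hab⟩
  have : Nonempty (Set.Ioo (p a) (p c)) := (Set.nonempty_Ioo.2 hac).to_subtype
  obtain ⟨g, hg⟩ := Nat.exists_strictMono (Set.Ioo (p a) (p c))
  obtain ⟨k, hinj, hlow, hhigh⟩ := exists_height_of_isPath hw
  set p' : V → ℚ := fun v => if v ∈ w.support then g (k v) else p v with hp'
  set q' : V → ℕ := fun v => if v ∈ w.support then m else q v with hq'
  have hAw : ∀ v ∈ A, v ∉ w.support := fun v hv hv' => hwA v hv' hv
  have pA : ∀ v ∈ A, p' v = p v := fun v hv => if_neg (hAw v hv)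
  have qA : ∀ v ∈ A, q' v = q v := fun v hv => if_neg (hAw v hv)
  have pX : ∀ v ∈ w.support, p' v = g (k v) := fun v hv => if_pos hv
  have qX : ∀ v ∈ w.support, q' v = m := fun v hv => if_pos hv
  have hgt : ∀ v ∈ w.support, p a < p' v := fun v hv => by rw [pX v hv]; exact (g (k v)).2.1
  have hlt : ∀ v ∈ w.support, p' v < p c := fun v hv => by rw [pX v hv]; exact (g (k v)).2.2
  have hmono : ∀ x ∈ w.support, ∀ y ∈ w.support, k x < k y → p' x < p' y := by
    intro x hx y hy hxy
    rw [pX x hx, pX y hy]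
    exact hg hxy
  have hdisj : ∀ v ∈ A, ∀ x ∈ w.support, p' v ≠ p' x := by
    intro v hv x hx heq
    rw [pA v hv] at heq
    have h₁ := hgt x hx
    have h₂ := hlt x hx
    rw [← heq] at h₁ h₂
    exact absurd (hc v ⟨hv, h₁⟩) (not_le.2 h₂)
  have hqle : ∀ v, v ∈ A ∪ {x | x ∈ w.support} → q' v ≤ m := by
    rintro v (hv | hv)
    · rw [qA v hv]
      exact (h.lt_step v hv).le
    · exact (qX v hv).le
  have hra := h.mem_r
  have hta := h.mem_t
  refine ⟨p', q', ⟨.inl hra, .inl hta, ?_, ?_, ?_, ?_, ?_, ?_, ?_, ?_, ?_⟩⟩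
  · rintro (hu | hu)
    exacts [h.notMem_u hu, huw hu]
  · intro v hv
    rw [Set.mem_union, not_or] at hv
    exact (hconn v hv.1 hv.2).mono fun x hx => by rintro (h | h); exacts [hx.1 h, hx.2 h]
  · rintro x (hx | hx) y (hy | hy) hxy
    · rw [pA x hx, pA y hy] at hxy
      exact h.injOn hx hy hxy
    · exact absurd hxy (hdisj x hx y hy)
    · exact absurd hxy.symm (hdisj y hy x hx)
    · rw [pX x hx, pX y hy] at hxy
      exact hinj hx hy (hg.injective (Subtype.ext hxy))
  · rintro v (hv | hv)
    · rw [pA v hv, pA r hra]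
      exact h.bot_le v hv
    · rw [pA r hra]
      exact (h.bot_le a ha).trans (hgt v hv).le
  · rintro v (hv | hv)
    · rw [pA v hv, pA t hta]
      exact h.le_top v hv
    · rw [pA t hta]
      exact (hlt v hv).le.trans (h.le_top c hcA)
  · intro v hv
    exact Nat.lt_succ_of_le (hqle v hv)
  · rintro v (hv | hv) hvr hvt
    · obtain ⟨d, hd, hvd, hpd, hqd⟩ := h.down v hv hvr hvt
      exact ⟨d, .inl hd, hvd, by rwa [pA v hv, pA d hd], by rwa [qA v hv, qA d hd]⟩
    · rcases hlow v hv with rfl | ⟨y, hy, hvy, hk⟩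
      · exact ⟨a, .inl ha, has.symm, by rw [pA a ha]; exact hgt v hv,
          by rw [qX v hv]; exact hqle a (.inl ha)⟩
      · exact ⟨y, .inr hy, hvy, hmono y hy v hv hk, by rw [qX v hv]; exact hqle y (.inr hy)⟩
  · rintro v (hv | hv) hvr hvt
    · obtain ⟨d, hd, hvd, hpd, hqd⟩ := h.up v hv hvr hvt
      exact ⟨d, .inl hd, hvd, by rwa [pA v hv, pA d hd], by rwa [qA v hv, qA d hd]⟩
    · rcases hhigh v hv with rfl | ⟨y, hy, hvy, hk⟩
      · exact ⟨b, .inl hb, hbe.symm, by rw [pA b hb]; exact (hlt v hv).trans_le (hc b ⟨hb, hab⟩),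
          by rw [qX v hv]; exact hqle b (.inl hb)⟩
      · exact ⟨y, .inr hy, hvy, hmono v hv y hy hk, by rw [qX v hv]; exact hqle y (.inr hy)⟩
  · rintro v (hv | hv) hvr hvt
    · obtain ⟨d, hvd, hdr, hdt, hd⟩ := h.out v hv hvr hvt
      refine ⟨d, hvd, hdr, hdt, ?_⟩
      rintro (hd' | hd')
      · rw [qA v hv, qA d hd']
        exact hd hd'
      · rw [qA v hv, qX d hd']
        exact h.lt_step v hv
    · obtain ⟨d, hdA, hdw, hvd⟩ := hout v hv
      refine ⟨d, hvd, fun h => hdA (h ▸ hra), fun h => hdA (h ▸ hta), ?_⟩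
      rintro (h | h)
      exacts [absurd h hdA, absurd h hdw]

/-- In a `3`-connected graph partial orders extend until only `u` is left. -/
lemma PartialTriOrder.exists_compl_singleton {V : Type} [Fintype V] {G : SimpleGraph V}
    (hG : IsKConnected 3 G) {r t u : V} (hrt : r ≠ t) {A : Set V} {p : V → ℚ} {q : V → ℕ} {m : ℕ}
    (h : PartialTriOrder G r t u A p q m) :
    ∃ p' q' m', PartialTriOrder G r t u {u}ᶜ p' q' m' := by
  induction A using WellFoundedGT.induction generalizing p q m with
  | ind A ih =>
    by_cases hA : A = {u}ᶜ
    · exact ⟨p, q, m, hA ▸ h⟩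
    obtain ⟨k, hkA, hku⟩ : ∃ k, k ∉ A ∧ k ≠ u := by
      by_contra! hcon
      refine hA (Set.Subset.antisymm ?_ fun v hv => ?_)
      · rintro v hv rfl
        exact h.notMem_u hv
      · by_contra hvA
        exact hv (hcon v hvA)
    obtain ⟨a, ha, b, hb, hab, s, e, has, hbe, w, hw, huw, hwA, hout, hconn⟩ :=
      exists_nonseparating_ear hG h.mem_r h.mem_t hrt h.notMem_u hkA hku h.connected
    have hlt : A < A ∪ {x | x ∈ w.support} := by
      refine lt_of_le_of_ne Set.subset_union_left fun heq => hwA s w.start_mem_support ?_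
      rw [heq]
      exact .inr w.start_mem_support
    rcases lt_or_gt_of_ne (fun hp => hab (h.injOn ha hb hp)) with hp | hp
    · obtain ⟨p', q', h'⟩ := h.add_ear ha hb hp has hbe hw huw hwA hout hconn
      exact ih _ hlt h'
    · obtain ⟨p', q', h'⟩ := h.add_ear (w := w.reverse) hb ha hp hbe has hw.reverse
        (by simpa using huw) (by simpa using hwA) (by simpa using hout) (by simpa using hconn)
      simp only [Walk.support_reverse, List.mem_reverse] at h'
      exact ih _ hlt h'

/-- Values in a linear order are replaced by their ranks. -/
lemma exists_rank {V β : Type} [Fintype V] [LinearOrder β] (f : V → β) :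
    ∃ g : V → ℕ, (∀ v, g v ≤ Fintype.card V) ∧ (∀ v w, f v ≤ f w → g v ≤ g w) ∧
      ∀ v w, f v < f w → g v < g w := by
  classical
  refine ⟨fun v => (Finset.univ.filter fun x => f x < f v).card, fun v => Finset.card_le_univ _,
    fun v w h => Finset.card_le_card fun x hx => ?_,
    fun v w h => Finset.card_lt_card ((Finset.ssubset_iff_of_subset fun x hx => ?_).2 ⟨v, ?_, ?_⟩)⟩
  · simp only [Finset.mem_filter, Finset.mem_univ, true_and] at hx ⊢
    exact hx.trans_le h
  · simp only [Finset.mem_filter, Finset.mem_univ, true_and] at hx ⊢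
    exact hx.trans h
  · simpa using h
  · simp

lemma IsKConnected.exists_triOrder {V : Type} [Fintype V] {G : SimpleGraph V}
    (hG : IsKConnected 3 G) (r : V) :
    ∃ (t u : V) (p q : V → ℕ), (∀ v, p v ≤ Fintype.card V) ∧ (∀ v, q v ≤ Fintype.card V) ∧
      TriOrder G id r t u p q := by
  classical
  have hex : ∀ x y : V, ∃ z, z ≠ x ∧ z ≠ y := by
    intro x y
    by_contra! hcon
    have h₁ : Fintype.card V ≤ ({x, y} : Finset V).card := Finset.card_le_card fun v _ => by
      rw [Finset.mem_insert, Finset.mem_singleton]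
      exact or_iff_not_imp_left.2 (hcon v)
    have h₂ : ({x, y} : Finset V).card ≤ 2 := Finset.card_le_two
    have h₃ := hG.1
    omega
  have hnbr : ∀ x, x ≠ r → ∃ y, y ≠ x ∧ y ≠ r ∧ G.Adj r y := by
    intro x hx
    obtain ⟨o, hor, hox⟩ := hex r x
    obtain ⟨c, rfl, y, hy, hcy, hyx, -⟩ := hG.exists_boundary (K := {r}) (k := r) rfl hor hx hx
      hox hox
    exact ⟨y, hyx, hy, hcy⟩
  obtain ⟨o, hor, -⟩ := hex r r
  obtain ⟨t, -, htr, hrt⟩ := hnbr o hor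
  obtain ⟨u, hut, hur, hru⟩ := hnbr t htr
  have hstart : PartialTriOrder G r t u {r, t} (fun v => if v = r then 0 else 1) (fun _ => 0) 1 := by
    refine ⟨by simp, by simp, by simp [hur, hut], fun v hv => ?_, ?_, ?_, ?_, by simp, ?_, ?_, ?_⟩
    · simp only [Set.mem_insert_iff, Set.mem_singleton_iff, not_or] at hv
      exact (hG.reachIn_compl (x := r) (y := t) ⟨hur, hut⟩ hv).mono fun x hx => by simpa using hx
    · rintro x (rfl | rfl) y (rfl | rfl) <;> simp [htr]
    · rintro x (rfl | rfl) <;> simp [htr]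
    · rintro x (rfl | rfl) <;> simp [htr]
    all_goals
      rintro x (rfl | rfl) h h'
      exacts [absurd rfl h, absurd rfl h']
  obtain ⟨p, q, m, h⟩ := hstart.exists_compl_singleton hG htr.symm
  obtain ⟨P, hPn, -, hP⟩ := exists_rank p
  -- Giving `u` the value `m`, above all others, makes a step to `u` a strict increase of `q`. Ranks
  -- then bound both orders by the number of vertices.
  obtain ⟨Q, hQn, hQle, hQ⟩ := exists_rank (Function.update q u m)
  have hqu : ∀ v, v ≠ u → Function.update q u m v = q v :=
    fun v hv => Function.update_of_ne hv _ _
  refine ⟨t, u, P, Q, hPn, hQn, ⟨?_, ?_, ?_, ?_⟩⟩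
  · rintro v (rfl | rfl)
    exacts [⟨r, hrt.symm, rfl⟩, ⟨r, hru.symm, rfl⟩]
  · intro v hvr hvt hvu
    obtain ⟨a, ha, hva, hp, hq⟩ := h.down v hvu hvr hvt
    refine ⟨a, hva, ?_, ha, hP _ _ hp, hQle _ _ (by rwa [hqu a ha, hqu v hvu])⟩
    rintro rfl
    exact absurd (h.le_top v hvu) (not_le.2 hp)
  · intro v hvr hvt hvu
    obtain ⟨a, ha, hva, hp, hq⟩ := h.up v hvu hvr hvt
    refine ⟨a, hva, ?_, ha, hP _ _ hp, hQle _ _ (by rwa [hqu a ha, hqu v hvu])⟩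
    rintro rfl
    exact absurd (h.bot_le v hvu) (not_le.2 hp)
  · intro v hvr hvt hvu
    obtain ⟨a, hva, har, hat, ha⟩ := h.out v hvu hvr hvt
    refine ⟨a, hva, har, hat, hQ _ _ ?_⟩
    rw [hqu v hvu]
    by_cases hau : a = u
    · rw [hau, Function.update_self]
      exact h.lt_step v hvu
    · rw [hqu a hau]
      exact ha hau

/-! ### Encoding the orders in labels. -/

/-- The part of a label that describes one order: the names of the three special vertices and the
two ranks of the vertex. -/
@[ext]
structure Mark where
  r : ℕ
  t : ℕ
  u : ℕ
  p : ℕ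
  q : ℕ

/-- A mark as a natural number. -/
def Mark.code (m : Mark) : ℕ :=
  Nat.pair (Nat.pair m.r m.t) (Nat.pair m.u (Nat.pair m.p m.q))

lemma Mark.code_injective : Function.Injective Mark.code := by
  intro m m' h
  simp only [Mark.code, Nat.pair_eq_pair] at h
  obtain ⟨⟨h₁, h₂⟩, h₃, h₄, h₅⟩ := h
  exact Mark.ext h₁ h₂ h₃ h₄ h₅

lemma size_pair_le {a b s : ℕ} (ha : a.size ≤ s) (hb : b.size ≤ s) :
    (Nat.pair a b).size ≤ 2 * s := by
  rw [Nat.size_le] at *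
  calc Nat.pair a b < (max a b + 1) ^ 2 := Nat.pair_lt_max_add_one_sq a b
    _ ≤ (2 ^ s) ^ 2 := Nat.pow_le_pow_left (max_lt ha hb) 2
    _ = 2 ^ (2 * s) := by rw [← pow_mul, mul_comm]

/-- Three nested pairings, each at most doubling the bit size, give the factor 8. -/
lemma Mark.size_code_le {m : Mark} {s : ℕ} (hr : m.r.size ≤ s) (ht : m.t.size ≤ s)
    (hu : m.u.size ≤ s) (hp : m.p.size ≤ s) (hq : m.q.size ≤ s) : m.code.size ≤ 8 * s := by
  have h₁ := size_pair_le hr ht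
  have h₂ := size_pair_le (hu.trans (show s ≤ 2 * s by omega)) (size_pair_le hp hq)
  exact (size_pair_le (h₁.trans (show 2 * s ≤ 2 * (2 * s) by omega)) h₂).trans (by omega)

/-- The label that carries four marks. -/
def encode (m : Fin 4 → Mark) : Label :=
  (Nat.pair (Nat.pair (m 0).code (m 1).code) (Nat.pair (m 2).code (m 3).code)).bits

lemma encode_injective : Function.Injective encode := by
  intro m m' h
  have hbits : Function.Injective Nat.bits := fun a b hab => by
    rw [← Nat.ofDigits_digits 2 a, ← Nat.ofDigits_digits 2 b, Nat.digits_two_eq_bits,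
      Nat.digits_two_eq_bits, hab]
  have h := hbits h
  simp only [Nat.pair_eq_pair] at h
  obtain ⟨⟨h₀, h₁⟩, h₂, h₃⟩ := h
  funext j
  fin_cases j
  exacts [Mark.code_injective h₀, Mark.code_injective h₁, Mark.code_injective h₂,
    Mark.code_injective h₃]

lemma length_encode_le {m : Fin 4 → Mark} {s : ℕ} (h : ∀ j, (m j).code.size ≤ s) :
    (encode m).length ≤ 4 * s := by
  rw [encode, Nat.size_eq_bits_len]
  exact (size_pair_le (size_pair_le (h 0) (h 1)) (size_pair_le (h 2) (h 3))).trans (by omega)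

/-- The marks that a label carries. -/
noncomputable def decode : Label → Fin 4 → Mark :=
  haveI : Nonempty (Fin 4 → Mark) := ⟨fun _ => ⟨0, 0, 0, 0, 0⟩⟩
  Function.invFun encode

lemma decode_encode (m : Fin 4 → Mark) : decode (encode m) = m :=
  haveI : Nonempty (Fin 4 → Mark) := ⟨fun _ => ⟨0, 0, 0, 0, 0⟩⟩
  Function.leftInverse_invFun encode_injective m

/-! ### The verifier: soundness and completeness. -/

/-- Each vertex checks that the four roots are distinct, that its neighbours agree with it on the
names of the special vertices, and the conditions of `TriOrder` at itself. -/
def verifier : Verifier := fun x =>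
  Function.Injective (fun j => (decode x.label j).r) ∧
  ∀ j, let m := decode x.label j
    (∀ n ∈ x.nbrs, (decode n.2.1 j).r = m.r ∧ (decode n.2.1 j).t = m.t ∧
      (decode n.2.1 j).u = m.u) ∧
    (x.ident = m.t ∨ x.ident = m.u → ∃ n ∈ x.nbrs, n.1 = m.r) ∧
    (x.ident ≠ m.r → x.ident ≠ m.t → x.ident ≠ m.u →
      (∃ n ∈ x.nbrs, n.1 ≠ m.t ∧ n.1 ≠ m.u ∧ (decode n.2.1 j).p < m.p ∧
        (decode n.2.1 j).q ≤ m.q) ∧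
      (∃ n ∈ x.nbrs, n.1 ≠ m.r ∧ n.1 ≠ m.u ∧ m.p < (decode n.2.1 j).p ∧
        (decode n.2.1 j).q ≤ m.q) ∧
      ∃ n ∈ x.nbrs, n.1 ≠ m.r ∧ n.1 ≠ m.t ∧ m.q < (decode n.2.1 j).q)

lemma eq_of_connected {V β : Type} {G : SimpleGraph V} (hG : G.Connected) {f : V → β}
    (hf : ∀ v w, G.Adj v w → f w = f v) (v w : V) : f v = f w := by
  obtain ⟨p⟩ := hG.preconnected v w
  induction p with
  | nil => rfl
  | cons h _ ih => exact (hf _ _ h).symm.trans ih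

/-- Agreement along edges makes the announced names global because `G` is connected. Labels outside
the range of `encode` need no separate test: they too decode to some marks, and the argument uses
only the checked conditions. -/
lemma isKConnected_of_accepts {V : Type} [Fintype V] {G : SimpleGraph V} {ident : V → ℕ}
    (hG : G.Connected) (hident : Function.Injective ident) {c : V → Label} {e : Sym2 V → Label}
    (h : verifier.Accepts G ident c e) : IsKConnected 3 G := by
  have : Nonempty V := hG.nonempty
  let o : V := Classical.arbitrary V
  let M : V → Fin 4 → Mark := fun v => decode (c v)
  have hagree : ∀ j v w, G.Adj v w →
      (M w j).r = (M v j).r ∧ (M w j).t = (M v j).t ∧ (M w j).u = (M v j).u :=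
    fun j v w hvw => ((h v).2 j).1 _ ⟨w, hvw, rfl⟩
  have hr : ∀ j v, (M v j).r = (M o j).r := fun j v =>
    eq_of_connected hG (fun v w hvw => (hagree j v w hvw).1) v o
  have ht : ∀ j v, (M v j).t = (M o j).t := fun j v =>
    eq_of_connected hG (fun v w hvw => (hagree j v w hvw).2.1) v o
  have hu : ∀ j v, (M v j).u = (M o j).u := fun j v =>
    eq_of_connected hG (fun v w hvw => (hagree j v w hvw).2.2) v o
  have hord : ∀ j v, ident v ≠ (M o j).r → ident v ≠ (M o j).t → ident v ≠ (M o j).u →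
      (∃ a, G.Adj v a ∧ ident a ≠ (M o j).t ∧ ident a ≠ (M o j).u ∧ (M a j).p < (M v j).p ∧
        (M a j).q ≤ (M v j).q) ∧
      (∃ a, G.Adj v a ∧ ident a ≠ (M o j).r ∧ ident a ≠ (M o j).u ∧ (M v j).p < (M a j).p ∧
        (M a j).q ≤ (M v j).q) ∧
      ∃ a, G.Adj v a ∧ ident a ≠ (M o j).r ∧ ident a ≠ (M o j).t ∧ (M v j).q < (M a j).q := by
    intro j v hvr hvt hvu
    rw [← hr j v] at hvr ⊢
    rw [← ht j v] at hvt ⊢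
    rw [← hu j v] at hvu ⊢
    obtain ⟨⟨_, ⟨a, ha, rfl⟩, h₁⟩, ⟨_, ⟨b, hb, rfl⟩, h₂⟩, ⟨_, ⟨d, hd, rfl⟩, h₃⟩⟩ :=
      ((h v).2 j).2.2 hvr hvt hvu
    exact ⟨⟨a, ha, h₁⟩, ⟨b, hb, h₂⟩, ⟨d, hd, h₃⟩⟩
  refine isKConnected_three_of_triOrder hident (r := fun j => (M o j).r) (t := fun j => (M o j).t)
    (u := fun j => (M o j).u) (p := fun j v => (M v j).p) (q := fun j v => (M v j).q) (h o).1
    fun j => ⟨fun v hv => ?_, fun v h₁ h₂ h₃ => (hord j v h₁ h₂ h₃).1,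
      fun v h₁ h₂ h₃ => (hord j v h₁ h₂ h₃).2.1, fun v h₁ h₂ h₃ => (hord j v h₁ h₂ h₃).2.2⟩
  rw [← hr j v]
  rw [← ht j v, ← hu j v] at hv
  obtain ⟨_, ⟨a, ha, rfl⟩, h₁⟩ := ((h v).2 j).2.1 hv
  exact ⟨a, ha, h₁⟩

lemma accepts_encode {V : Type} {G : SimpleGraph V} {ident : V → ℕ} {r t u : Fin 4 → ℕ}
    {p q : Fin 4 → V → ℕ} (hr : Function.Injective r)
    (h : ∀ j, TriOrder G ident (r j) (t j) (u j) (p j) (q j)) (e : Sym2 V → Label) :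
    verifier.Accepts G ident (fun v => encode fun j => ⟨r j, t j, u j, p j v, q j v⟩) e := by
  intro v
  simp only [verifier, view, decode_encode]
  refine ⟨hr, fun j => ⟨?_, fun hv => ?_, fun h₁ h₂ h₃ => ⟨?_, ?_, ?_⟩⟩⟩
  · rintro _ ⟨w, -, rfl⟩
    simp [decode_encode]
  · obtain ⟨a, ha, har⟩ := (h j).root v hv
    exact ⟨_, ⟨a, ha, rfl⟩, har⟩
  · obtain ⟨a, ha, h'⟩ := (h j).down v h₁ h₂ h₃
    exact ⟨_, ⟨a, ha, rfl⟩, by simpa [decode_encode] using h'⟩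
  · obtain ⟨a, ha, h'⟩ := (h j).up v h₁ h₂ h₃
    exact ⟨_, ⟨a, ha, rfl⟩, by simpa [decode_encode] using h'⟩
  · obtain ⟨a, ha, h'⟩ := (h j).out v h₁ h₂ h₃
    exact ⟨_, ⟨a, ha, rfl⟩, by simpa [decode_encode] using h'⟩

lemma IsKConnected.exists_accepts {V : Type} [Fintype V] {G : SimpleGraph V} {ident : V → ℕ}
    {k : ℕ} (hG : IsKConnected 3 G) (hident : IsIdent k ident) (e : Sym2 V → Label) :
    ∃ c : V → Label, (∀ v, (c v).length ≤ 32 * (Fintype.card V ^ (k + 1)).size) ∧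
      verifier.Accepts G ident c e := by
  obtain ⟨root⟩ : Nonempty (Fin 4 ↪ V) :=
    Function.Embedding.nonempty_of_card_le (by simpa [Nat.succ_le_iff] using hG.1)
  choose t u p q hp hq h using fun j => hG.exists_triOrder (root j)
  have hpos : 0 < Fintype.card V := by have := hG.1; omega
  refine ⟨_, fun v => ?_, accepts_encode (hident.1.comp root.injective)
    (fun j => (h j).rename hident.1) e⟩
  -- The exponent `k + 1` covers both identifiers, at most `n ^ k`, and ranks, at most `n`, even
  -- when `k = 0`.
  have hid : ∀ v, (ident v).size ≤ (Fintype.card V ^ (k + 1)).size := fun v =>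
    Nat.size_le_size ((hident.2 v).2.trans (Nat.pow_le_pow_right hpos (by omega)))
  have hrank : ∀ n, n ≤ Fintype.card V → n.size ≤ (Fintype.card V ^ (k + 1)).size := fun n hn =>
    Nat.size_le_size (hn.trans (Nat.le_self_pow (by omega) _))
  refine (length_encode_le (s := 8 * (Fintype.card V ^ (k + 1)).size) fun j =>
    Mark.size_code_le (hid _) (hid _) (hid _) (hrank _ (hp j v)) (hrank _ (hq j v))).trans
      (by omega)

lemma isBigO_size_pow_log (C k : ℕ) :
    (fun n : ℕ => ((C * (n ^ k).size : ℕ) : ℝ)) =O[Filter.atTop] fun n : ℕ => Real.log n := by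
  -- The term `k / log 2` comes from the binary logarithm of `n ^ k`; `1 / log 2` absorbs the
  -- additional bit, as `log 2 ≤ log n` for `n ≥ 2`.
  refine Asymptotics.IsBigO.of_bound (C * (k / Real.log 2 + 1 / Real.log 2)) ?_
  filter_upwards [Filter.eventually_ge_atTop 2] with n hn
  have hn' : (2 : ℝ) ≤ n := by exact_mod_cast hn
  have h2 : 0 < Real.log 2 := Real.log_pos one_lt_two
  have hlog : Real.log 2 ≤ Real.log n := Real.log_le_log two_pos hn'
  have hpos : 0 < n ^ k := by positivity
  have hsize : (n ^ k).size ≤ Nat.log 2 (n ^ k) + 1 :=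
    Nat.size_le.2 (Nat.lt_pow_succ_log_self one_lt_two _)
  have hle : (Nat.log 2 (n ^ k) : ℝ) * Real.log 2 ≤ k * Real.log n := by
    rw [← Real.log_pow, ← Real.log_pow]
    refine Real.log_le_log (by positivity) ?_
    exact_mod_cast Nat.pow_log_le_self 2 hpos.ne'
  have hsize' : ((n ^ k).size : ℝ) ≤ Nat.log 2 (n ^ k) + 1 := by exact_mod_cast hsize
  have hmain : ((n ^ k).size : ℝ) ≤ (k / Real.log 2 + 1 / Real.log 2) * Real.log n := by
    rw [← add_div, div_mul_eq_mul_div, le_div_iff₀ h2]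
    nlinarith
  rw [Real.norm_of_nonneg (by positivity), Real.norm_of_nonneg (h2.le.trans hlog)]
  push_cast
  rw [mul_assoc]
  gcongr

end LocalCert

theorem mainTheorem8 (k : ℕ) :
    ∃ f g : ℕ → ℕ,
      (fun n => (f n : ℝ)) =O[Filter.atTop] (fun n : ℕ => Real.log (n : ℝ)) ∧
      (fun n => (g n : ℝ)) =O[Filter.atTop] (fun _ : ℕ => (1 : ℝ)) ∧
      LocalCert.CertifiableWith k (fun {V} [Fintype V] (G : SimpleGraph V) =>
        LocalCert.IsKConnected 3 G) f g := by
  refine ⟨fun n => 32 * (n ^ (k + 1)).size, fun _ => 0, LocalCert.isBigO_size_pow_log 32 (k + 1),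
    Asymptotics.isBigO_const_const _ one_ne_zero _, LocalCert.verifier,
    fun V _ G ident hconn hident => ⟨fun hG => ?_, fun hG c e h => ?_⟩⟩
  · obtain ⟨c, hc, h⟩ := LocalCert.IsKConnected.exists_accepts hG hident fun _ => []
    exact ⟨c, fun _ => [], hc, fun _ _ => le_rfl, h⟩
  · exact hG (LocalCert.isKConnected_of_accepts hconn hident.1 h)
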